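/- Let $a<b$, $\rho>0$, $\tau>0$, let $m\ge 1$ be an integer and $k$ an even positive integer. For $g:[c,d]\to\mathbb R$ let $\mathtt{Trap}(g,c,d,n)=\frac{d-c}{2n}\bigl(g(c)+g(d)+2\sum_{i=1}^{n-1}g(c+\tfrac{i(d-c)}{n})\bigr)$. The procedure $\mathtt{AdapTrap}_{\rho,m,k}(f,c,d,t)$ computes $Q_1=\mathtt{Trap}(f,c,d,m)$ and $Q_2=\mathtt{Trap}(f,c,d,2m)$. If $|Q_2-Q_1|<t$ it returns $Q_2$ and makes no further calls; otherwise it returns $\sum_{j=0}^{k-1}\mathtt{AdapTrap}_{\rho,m,k}\bigl(f,c+\tfrac{(d-c)j}{k},c+\tfrac{(d-c)(j+1)}{k},\rho t\bigr)$. A full $k$-ary tree is a non-empty, possibly infinite, rooted ordered tree in which every node has exactly $k$ children or none; nodes without children are leaves and the other nodes are inner nodes. (Trees are determined by the positions of their nodes: the $p$-th possible node at depth $q$, $1\le p\le k^q$, is labelled $(p,q)$.) For $f\in C([a,b])$ let $A_{\rho,m,k,\tau}(f)$ be the full $k$-ary tree of recursive calls made in running $\mathtt{AdapTrap}_{\rho,m,k}(f,a,b,\tau)$: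 the root is the initial call, and the children of a call that subdivides are its $k$ sub-calls, ordered from left to right. Let $\lambda>0$ and $\gamma\in\mathbb R$, and let $\mathbb P^*$ be the law on $C([a,b])$, with the Borel $\sigma$-algebra of the supremum norm, of a continuous Gaussian process with mean $0$ and covariance function $(x,y)\mapsto\lambda\min(x,y)+\gamma$ (such a law exists if and only if $\lambda a+\gamma\ge 0$). Let $T$ be a finite full $k$-ary tree of height $D$ (the largest depth of a node), with $L_i$ leaves and $V_i$ inner nodes at depth $i$. Then $$\mathbb P^*\bigl(A_{\rho,m,k,\tau}=T\bigr)=\prod_{i=0}^{D}\alpha_i^{L_i}(1-\alpha_i)^{V_i},\qquad \alpha_i=\mathbb P\left(|Z|<\frac{4m\tau\,(k^{3/2}\rho)^i}{\sqrt{\lambda(b-a)^3}}\right),\quad Z\sim\mathcal N(0,1).$$ -/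

import Mathlib

open MeasureTheory ProbabilityTheory

/-- A (possibly infinite) full `k`-ary tree. A node is encoded by the word of child indices on the
path from the root to it: the root is `[]`, the children of `v` are the words `v ++ [j]` with
`j : Fin k`, and the `p`-th possible node at depth `q` is the word of length `q` that writes `p - 1`
in base `k`. Every node has either exactly `k` children or none. -/
@[ext]
structure FullKaryTree (k : ℕ) where
  /-- The set of nodes. -/
  nodes : Set (List (Fin k))
  root_mem : [] ∈ nodes
  parent_mem : ∀ v j, v ++ [j] ∈ nodes → v ∈ nodes
  sibling_mem : ∀ v i j, v ++ [i] ∈ nodes → v ++ [j] ∈ nodes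

namespace FullKaryTree

variable {k : ℕ}

/-- The tree is finite, i.e. it has finitely many nodes. -/
def IsFinite (T : FullKaryTree k) : Prop := T.nodes.Finite

/-- A leaf is a node without children. -/
def IsLeaf (T : FullKaryTree k) (v : List (Fin k)) : Prop :=
  v ∈ T.nodes ∧ ∀ j, v ++ [j] ∉ T.nodes

/-- An inner node is a node that has children. -/
def IsInner (T : FullKaryTree k) (v : List (Fin k)) : Prop :=
  v ∈ T.nodes ∧ ∃ j, v ++ [j] ∈ T.nodes

/-- The height is the supremum of the depths of the nodes; the depth of `v` is its length. -/
noncomputable def height (T : FullKaryTree k) : ℕ∞ := ⨆ v ∈ T.nodes, (v.length : ℕ∞)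

/-- The number of leaves at depth `i`. -/
noncomputable def numLeaves (T : FullKaryTree k) (i : ℕ) : ℕ :=
  {v | T.IsLeaf v ∧ v.length = i}.ncard

/-- The number of inner nodes at depth `i`. -/
noncomputable def numInner (T : FullKaryTree k) (i : ℕ) : ℕ :=
  {v | T.IsInner v ∧ v.length = i}.ncard

end FullKaryTree

/-- The composite trapezoidal rule on `n` intervals of equal length. -/
noncomputable def trap (g : ℝ → ℝ) (a b : ℝ) (n : ℕ) : ℝ :=
  (b - a) / (2 * n) *
    (g a + g b + 2 * ∑ i ∈ Finset.Ico 1 n, g (a + i * (b - a) / n))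

/-- The acceptance test `|Q₂ - Q₁| < τ` of one step of the adaptive trapezium method. -/
def Accepts (m : ℕ) (g : ℝ → ℝ) (a b τ : ℝ) : Prop :=
  |trap g a b (2 * m) - trap g a b m| < τ

/-- The recursion of `AdapTrap_{ρ,m,k}(g, a, b, τ)`: does the word `v` lead to a recursive call?
The empty word is the call itself. If the call accepts its estimate it makes no further calls;
otherwise it calls itself, for each `j : Fin k`, on the `j`-th of the `k` equal subintervals with
tolerance `ρ * τ`. -/
def IsCall (ρ : ℝ) (m k : ℕ) (g : ℝ → ℝ) (a b τ : ℝ) : List (Fin k) → Prop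
  | [] => True
  | j :: v => ¬ Accepts m g a b τ ∧
      IsCall ρ m k g (a + (b - a) * (j : ℕ) / k) (a + (b - a) * ((j : ℕ) + 1) / k) (ρ * τ) v

theorem IsCall.parent {ρ : ℝ} {m k : ℕ} {g : ℝ → ℝ} (v : List (Fin k)) (j : Fin k) :
    ∀ {a b τ : ℝ}, IsCall ρ m k g a b τ (v ++ [j]) → IsCall ρ m k g a b τ v := by
  induction v with
  | nil => intro a b τ _; trivial
  | cons i v ih => intro a b τ h; exact ⟨h.1, ih h.2⟩

theorem IsCall.sibling {ρ : ℝ} {m k : ℕ} {g : ℝ → ℝ} (v : List (Fin k)) (i j : Fin k) :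
    ∀ {a b τ : ℝ}, IsCall ρ m k g a b τ (v ++ [i]) → IsCall ρ m k g a b τ (v ++ [j]) := by
  induction v with
  | nil => intro a b τ h; exact ⟨h.1, trivial⟩
  | cons l v ih => intro a b τ h; exact ⟨h.1, ih h.2⟩

/-- The tree of recursive calls made in the running of `AdapTrap_{ρ,m,k}(g, a, b, τ)`. -/
def recursionTree (ρ : ℝ) (m k : ℕ) (g : ℝ → ℝ) (a b τ : ℝ) : FullKaryTree k where
  nodes := {v | IsCall ρ m k g a b τ v}
  root_mem := trivial
  parent_mem v j := IsCall.parent v j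
  sibling_mem v i j := IsCall.sibling v i j

/-- The map `A_{ρ,m,k,τ}` from continuous functions on `[a,b]` to full `k`-ary trees. The method
evaluates its integrand only at points of `[a,b]`, so the extension of `f` to the line is
immaterial. -/
noncomputable def adapTrapTree (ρ : ℝ) (m k : ℕ) (τ : ℝ) {a b : ℝ} (hab : a < b)
    (f : C(Set.Icc a b, ℝ)) : FullKaryTree k :=
  recursionTree ρ m k (Set.IccExtend hab.le f) a b τ

/-- `P` is the law on `C([a,b])` of a shifted and scaled Wiener process: under `P` the evaluations
`f ↦ f x` form a Gaussian process with mean `0` and covariance `lam * min x y + γ`. -/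
structure IsShiftedScaledWienerLaw {a b : ℝ} (lam γ : ℝ) [MeasurableSpace C(Set.Icc a b, ℝ)]
    (P : Measure C(Set.Icc a b, ℝ)) : Prop where
  isGaussianProcess :
    IsGaussianProcess (fun (x : Set.Icc a b) (f : C(Set.Icc a b, ℝ)) ↦ f x) P
  mean_eq : ∀ x : Set.Icc a b, ∫ f, f x ∂P = 0
  cov_eq : ∀ x y : Set.Icc a b,
    covariance (fun f : C(Set.Icc a b, ℝ) ↦ f x) (fun f : C(Set.Icc a b, ℝ) ↦ f y) P
      = lam * min (x : ℝ) (y : ℝ) + γ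

/-- The probability `α_i` that a standard normal variable `Z` satisfies
`|Z| < 4 m τ (k^{3/2} ρ)^i / √(lam (b - a)^3)`. -/
noncomputable def acceptProb (ρ : ℝ) (m k : ℕ) (τ a b lam : ℝ) (i : ℕ) : ℝ :=
  (gaussianReal 0 1).real
    {z | |z| < 4 * m * τ * ((k : ℝ) ^ (3 / 2 : ℝ) * ρ) ^ i / √(lam * (b - a) ^ 3)}

/-! A call stops exactly when its two trapezium estimates differ by less than its tolerance, and
that difference is a weighted sum of second differences of the integrand over the `m` cells of the
coarse rule (`trapDiff_eq_sum`). Under the given law these differences, taken over all possible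
calls, are jointly Gaussian with mean zero.

Second differences annihilate affine functions, and `min x ·` is affine on any interval without `x`
in its interior. So `γ` drops out, and a second difference is uncorrelated with the value at any
point outside its open interval. As `k` is even, no endpoint or midpoint of a cell of a shallower
call lies strictly inside a cell of a deeper one. Distinct calls therefore have uncorrelated
differences (`covariance_trapDiff_eq_zero`), which joint Gaussianity turns into independence.

The variance (`variance_trapDiff`) depends on the depth only, and gives the acceptance probability
`α_i`. The recursion tree equals `T` iff among the nodes of `T` exactly the leaves accept
(`recursionTree_eq_iff`), a finite intersection of independent events. -/

namespace ProbabilityTheory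

/-- Linear combinations of the values of a Gaussian process form a Gaussian process. -/
theorem IsGaussianProcess.fun_sum_mul {Ω S U ι : Type*} {mΩ : MeasurableSpace Ω} {P : Measure Ω}
    {X : S → Ω → ℝ} (hX : IsGaussianProcess X P) (J : U → Finset ι) (c : U → ι → ℝ)
    (s : U → ι → S) :
    IsGaussianProcess (fun u ω ↦ ∑ i ∈ J u, c u i * X (s u i) ω) P := by
  classical
  refine hX.of_isGaussianProcess fun u ↦ ⟨(J u).image (s u),
    ∑ i ∈ (J u).attach, c u i • ContinuousLinearMap.proj
      (⟨s u i, Finset.mem_image_of_mem _ i.2⟩ : (J u).image (s u)), fun ω ↦ ?_⟩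
  rw [← Finset.sum_attach]
  simp

/-- The probability that a centred normal variable of standard deviation `σ` lies in `(-t, t)`. -/
theorem gaussianReal_real_abs_lt (σ : ℝ) (hσ : 0 < σ) (t : ℝ) :
    (gaussianReal 0 (σ ^ 2).toNNReal).real {z | |z| < t} =
      (gaussianReal 0 1).real {z | |z| < t / σ} := by
  have h : gaussianReal 0 (σ ^ 2).toNNReal = (gaussianReal 0 1).map (σ * ·) := by
    rw [gaussianReal_map_const_mul, mul_zero, mul_one]
    congr 1
    ext
    simp [Real.coe_toNNReal _ (sq_nonneg σ)]
  rw [h, map_measureReal_apply (by fun_prop) (measurableSet_lt (by fun_prop) (by fun_prop))]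
  congr 1
  ext z
  simp [abs_mul, abs_of_pos hσ, lt_div_iff₀ hσ, mul_comm]

end ProbabilityTheory

/-! ### Trapezium differences as sums of second differences -/

/-- The second difference of `g` on `[s, t]`. -/
noncomputable def secondDiff (g : ℝ → ℝ) (s t : ℝ) : ℝ := 2 * g ((s + t) / 2) - g s - g t

/-- The difference between two successive trapezium estimates. -/
noncomputable def trapDiff (m : ℕ) (g : ℝ → ℝ) (c d : ℝ) : ℝ := trap g c d (2 * m) - trap g c d m

/-- On the left an odd index gets weight 2, an interior even index 2 - 4 = -2, an end index -1.
Splitting each -2 between the two adjacent cells gives the right side. -/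
theorem sum_Ico_one_two_mul_sub (G : ℕ → ℝ) {m : ℕ} (hm : 0 < m) :
    (G 0 + G (2 * m) + 2 * ∑ i ∈ Finset.Ico 1 (2 * m), G i) -
      2 * (G 0 + G (2 * m) + 2 * ∑ i ∈ Finset.Ico 1 m, G (2 * i)) =
    ∑ l ∈ Finset.range m, (2 * G (2 * l + 1) - G (2 * l) - G (2 * l + 2)) := by
  induction m, hm using Nat.le_induction with
  | base => simp; ring
  | succ m hm ih =>
    rw [Finset.sum_range_succ, ← ih, Finset.sum_Ico_succ_top hm,
      show 2 * (m + 1) = 2 * m + 1 + 1 by ring, Finset.sum_Ico_succ_top (by omega),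
      Finset.sum_Ico_succ_top (by omega)]
    ring

theorem trapDiff_eq_sum {m : ℕ} (hm : 0 < m) (g : ℝ → ℝ) (c d : ℝ) :
    trapDiff m g c d = ∑ l ∈ Finset.range m, (d - c) / (4 * m) *
      secondDiff g (c + (d - c) * (l / m)) (c + (d - c) * ((l + 1) / m)) := by
  have hm' : (m : ℝ) ≠ 0 := by positivity
  have h := sum_Ico_one_two_mul_sub (fun n ↦ g (c + n * (d - c) / (2 * m))) hm
  rw [← Finset.mul_sum]
  have h2 : ∀ l ∈ Finset.range m,
      secondDiff g (c + (d - c) * (l / m)) (c + (d - c) * ((l + 1) / m)) =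
      2 * g (c + (2 * l + 1 : ℕ) * (d - c) / (2 * m)) - g (c + (2 * l : ℕ) * (d - c) / (2 * m)) -
        g (c + (2 * l + 2 : ℕ) * (d - c) / (2 * m)) := by
    intro l _
    rw [secondDiff]
    congr 3
    · congr 1; push_cast; field_simp; ring
    · push_cast; field_simp
    · push_cast; field_simp
  rw [Finset.sum_congr rfl h2, ← h]
  have e0 : c + ((0 : ℕ) : ℝ) * (d - c) / (2 * m) = c := by simp
  have e1 : c + ((2 * m : ℕ) : ℝ) * (d - c) / (2 * m) = d := by push_cast; field_simp; ring
  have e2 : ∀ i ∈ Finset.Ico 1 m, g (c + ((2 * i : ℕ) : ℝ) * (d - c) / (2 * m)) =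
      g (c + i * (d - c) / m) := by
    intro i _; congr 1; push_cast; field_simp
  simp only [e0, e1]
  rw [Finset.sum_congr rfl e2]
  simp only [trapDiff, trap]
  push_cast
  field_simp
  ring

/-! ### Covariances of the trapezium differences -/

section Covariance

variable {Ω : Type*} {mΩ : MeasurableSpace Ω} {P : Measure Ω} {B : ℝ → Ω → ℝ} {a b lam γ : ℝ}

theorem isGaussianProcess_secondDiff (hB : IsGaussianProcess B P) :
    IsGaussianProcess (fun (p : ℝ × ℝ) ω ↦ secondDiff (B · ω) p.1 p.2) P := by
  convert hB.fun_sum_mul (fun _ : ℝ × ℝ ↦ (Finset.univ : Finset (Fin 3)))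
    (fun _ ↦ ![2, -1, -1]) (fun p ↦ ![(p.1 + p.2) / 2, p.1, p.2]) using 3 with p ω
  simp [secondDiff, Fin.sum_univ_three]
  ring

theorem isGaussianProcess_trapDiff (hB : IsGaussianProcess B P) {m : ℕ} (hm : 0 < m) :
    IsGaussianProcess (fun (p : ℝ × ℝ) ω ↦ trapDiff m (B · ω) p.1 p.2) P := by
  simp only [trapDiff_eq_sum hm]
  exact (isGaussianProcess_secondDiff hB).fun_sum_mul (fun _ ↦ Finset.range m)
    (fun (p : ℝ × ℝ) _ ↦ (p.2 - p.1) / (4 * m))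
    (fun (p : ℝ × ℝ) (l : ℕ) ↦ (p.1 + (p.2 - p.1) * (l / m), p.1 + (p.2 - p.1) * ((l + 1) / m)))

theorem memLp_secondDiff (hB : IsGaussianProcess B P) (s t : ℝ) :
    MemLp (fun ω ↦ secondDiff (B · ω) s t) 2 P :=
  ((isGaussianProcess_secondDiff hB).hasGaussianLaw_eval (s, t)).memLp_two

theorem covariance_secondDiff_right (hB : IsGaussianProcess B P) {X : Ω → ℝ} (hX : MemLp X 2 P)
    (s t : ℝ) :
    cov[X, fun ω ↦ secondDiff (B · ω) s t; P] =
      2 * cov[X, B ((s + t) / 2); P] - cov[X, B s; P] - cov[X, B t; P] := by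
  have := hB.isProbabilityMeasure
  have h (x : ℝ) : MemLp (B x) 2 P := (hB.hasGaussianLaw_eval x).memLp_two
  simp only [secondDiff]
  have h2 := (h ((s + t) / 2)).const_mul 2
  have h3 : MemLp (fun ω ↦ 2 * B ((s + t) / 2) ω - B s ω) 2 P := h2.sub (h s)
  rw [covariance_fun_sub_right hX h3 (h t), covariance_fun_sub_right hX h2 (h s),
    covariance_const_mul_right]

theorem covariance_eval_secondDiff (hB : IsGaussianProcess B P)
    (hcov : ∀ x ∈ Set.Icc a b, ∀ y ∈ Set.Icc a b, cov[B x, B y; P] = lam * min x y + γ)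
    {s t x : ℝ} (hs : a ≤ s) (hst : s ≤ t) (ht : t ≤ b) (hx : x ∈ Set.Icc a b) :
    cov[B x, fun ω ↦ secondDiff (B · ω) s t; P] =
      lam * (2 * min x ((s + t) / 2) - min x s - min x t) := by
  rw [covariance_secondDiff_right hB (hB.hasGaussianLaw_eval x).memLp_two,
    hcov x hx _ ⟨by linarith, by linarith⟩, hcov x hx _ ⟨by linarith, by linarith⟩,
    hcov x hx _ ⟨by linarith, by linarith⟩]
  ring

/-- On `[s, t]` the function `min x ·` is constant if `x ≤ s` and the identity if `t ≤ x`; second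
differences kill both. -/
theorem covariance_eval_secondDiff_eq_zero (hB : IsGaussianProcess B P)
    (hcov : ∀ x ∈ Set.Icc a b, ∀ y ∈ Set.Icc a b, cov[B x, B y; P] = lam * min x y + γ)
    {s t x : ℝ} (hs : a ≤ s) (hst : s ≤ t) (ht : t ≤ b) (hx : x ∈ Set.Icc a b)
    (h : x ≤ s ∨ t ≤ x) :
    cov[B x, fun ω ↦ secondDiff (B · ω) s t; P] = 0 := by
  rw [covariance_eval_secondDiff hB hcov hs hst ht hx]
  rcases h with h | h
  · rw [min_eq_left h, min_eq_left (by linarith), min_eq_left (by linarith)]; ring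
  · rw [min_eq_right h, min_eq_right (by linarith), min_eq_right (by linarith)]; ring

theorem covariance_secondDiff_eq_zero (hB : IsGaussianProcess B P)
    (hcov : ∀ x ∈ Set.Icc a b, ∀ y ∈ Set.Icc a b, cov[B x, B y; P] = lam * min x y + γ)
    {s t s' t' : ℝ} (hs : a ≤ s) (hst : s ≤ t) (ht : t ≤ b)
    (hs' : a ≤ s') (hst' : s' ≤ t') (ht' : t' ≤ b)
    (h0 : s ≤ s' ∨ t' ≤ s) (h1 : (s + t) / 2 ≤ s' ∨ t' ≤ (s + t) / 2) (h2 : t ≤ s' ∨ t' ≤ t) :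
    cov[fun ω ↦ secondDiff (B · ω) s t, fun ω ↦ secondDiff (B · ω) s' t'; P] = 0 := by
  rw [covariance_comm, covariance_secondDiff_right hB (memLp_secondDiff hB s' t')]
  simp only [covariance_comm _ (B _)]
  rw [covariance_eval_secondDiff_eq_zero hB hcov hs' hst' ht' ⟨by linarith, by linarith⟩ h0,
    covariance_eval_secondDiff_eq_zero hB hcov hs' hst' ht' ⟨by linarith, by linarith⟩ h1,
    covariance_eval_secondDiff_eq_zero hB hcov hs' hst' ht' ⟨by linarith, by linarith⟩ h2]
  ring

/-- Only the midpoint correlates with the second difference; it contributes `2 * lam * ((s + t) / 2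
- s)`. -/
theorem covariance_secondDiff_self (hB : IsGaussianProcess B P)
    (hcov : ∀ x ∈ Set.Icc a b, ∀ y ∈ Set.Icc a b, cov[B x, B y; P] = lam * min x y + γ)
    {s t : ℝ} (hs : a ≤ s) (hst : s ≤ t) (ht : t ≤ b) :
    cov[fun ω ↦ secondDiff (B · ω) s t, fun ω ↦ secondDiff (B · ω) s t; P] = lam * (t - s) := by
  rw [covariance_secondDiff_right hB (memLp_secondDiff hB s t)]
  simp only [covariance_comm _ (B _)]
  rw [covariance_eval_secondDiff_eq_zero hB hcov hs hst ht ⟨by linarith, by linarith⟩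
      (Or.inl le_rfl),
    covariance_eval_secondDiff_eq_zero hB hcov hs hst ht ⟨by linarith, by linarith⟩
      (Or.inr le_rfl),
    covariance_eval_secondDiff hB hcov hs hst ht ⟨by linarith, by linarith⟩,
    min_self, min_eq_right (by linarith), min_eq_left (by linarith)]
  ring

theorem covariance_trapDiff (hB : IsGaussianProcess B P) {m : ℕ} (hm : 0 < m) (c d c' d' : ℝ) :
    cov[fun ω ↦ trapDiff m (B · ω) c d, fun ω ↦ trapDiff m (B · ω) c' d'; P] =
      ∑ l ∈ Finset.range m, ∑ l' ∈ Finset.range m,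
        (d - c) / (4 * m) * ((d' - c') / (4 * m) *
          cov[fun ω ↦ secondDiff (B · ω) (c + (d - c) * (l / m)) (c + (d - c) * ((l + 1) / m)),
            fun ω ↦ secondDiff (B · ω) (c' + (d' - c') * (l' / m))
              (c' + (d' - c') * ((l' + 1) / m)); P]) := by
  have := hB.isProbabilityMeasure
  simp only [trapDiff_eq_sum hm]
  rw [covariance_fun_sum_fun_sum' (fun _ _ ↦ (memLp_secondDiff hB _ _).const_mul _)
    (fun _ _ ↦ (memLp_secondDiff hB _ _).const_mul _)]
  simp only [covariance_const_mul_left, covariance_const_mul_right, mul_left_comm]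

theorem variance_trapDiff (hB : IsGaussianProcess B P)
    (hcov : ∀ x ∈ Set.Icc a b, ∀ y ∈ Set.Icc a b, cov[B x, B y; P] = lam * min x y + γ)
    {m : ℕ} (hm : 0 < m) {c d : ℝ} (hc : a ≤ c) (hcd : c ≤ d) (hd : d ≤ b) :
    Var[fun ω ↦ trapDiff m (B · ω) c d; P] = lam * (d - c) ^ 3 / (16 * m ^ 2) := by
  have hm' : (0 : ℝ) < m := by positivity
  rw [← covariance_self
    ((isGaussianProcess_trapDiff hB hm).hasGaussianLaw_eval (c, d)).aemeasurable,
    covariance_trapDiff hB hm]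
  have mono {x y : ℝ} (h : x ≤ y) : c + (d - c) * (x / m) ≤ c + (d - c) * (y / m) := by
    have : 0 ≤ d - c := by linarith
    gcongr
  have lb {x : ℝ} (hx : 0 ≤ x) : a ≤ c + (d - c) * (x / m) := by
    have := mono hx; simp at this ⊢; linarith
  have ub {x : ℝ} (hx : x ≤ m) : c + (d - c) * (x / m) ≤ b := by
    have := mono hx; rw [div_self hm'.ne'] at this; linarith
  have cast_le {l : ℕ} (hl : l ∈ Finset.range m) : (l : ℝ) + 1 ≤ m := by
    exact_mod_cast Finset.mem_range.1 hl
  have key : ∀ l ∈ Finset.range m, (∑ l' ∈ Finset.range m,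
        (d - c) / (4 * m) * ((d - c) / (4 * m) *
          cov[fun ω ↦ secondDiff (B · ω) (c + (d - c) * (l / m)) (c + (d - c) * ((l + 1) / m)),
            fun ω ↦ secondDiff (B · ω) (c + (d - c) * (l' / m))
              (c + (d - c) * ((l' + 1) / m)); P])) = lam * (d - c) ^ 3 / (16 * m ^ 3) := by
    intro l hl
    -- Distinct cells have disjoint interiors, so only the diagonal term survives.
    rw [Finset.sum_eq_single_of_mem l hl]
    · rw [covariance_secondDiff_self hB hcov (lb (by positivity)) (mono (by linarith))
        (ub (cast_le hl))]
      field_simp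
      ring
    · intro l' hl' hne
      have h1 := mono (show (l : ℝ) ≤ l + 1 by linarith)
      have h : c + (d - c) * ((l + 1) / m) ≤ c + (d - c) * (l' / m) ∨
          c + (d - c) * ((l' + 1) / m) ≤ c + (d - c) * (l / m) := by
        rcases lt_or_gt_of_ne hne with h | h
        · right; apply mono; exact_mod_cast h
        · left; apply mono; exact_mod_cast h
      rw [covariance_secondDiff_eq_zero hB hcov (lb (by positivity)) h1
        (ub (cast_le hl)) (lb (by positivity)) (mono (by linarith)) (ub (cast_le hl'))]
      · simp
      · exact h.imp (fun h ↦ by linarith) (fun h ↦ by linarith)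
      · exact h.imp (fun h ↦ by linarith) (fun h ↦ by linarith)
      · exact h.imp (fun h ↦ by linarith) (fun h ↦ by linarith)
  rw [Finset.sum_congr rfl key, Finset.sum_const, Finset.card_range, nsmul_eq_mul]
  field_simp

theorem integral_trapDiff (hB : IsGaussianProcess B P) (hmean : ∀ x, P[B x] = 0)
    {m : ℕ} (hm : 0 < m) (c d : ℝ) : ∫ ω, trapDiff m (B · ω) c d ∂P = 0 := by
  have h (x : ℝ) : Integrable (B x) P := (hB.hasGaussianLaw_eval x).integrable
  have hD (s t : ℝ) : ∫ ω, secondDiff (B · ω) s t ∂P = 0 := by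
    simp only [secondDiff]
    have h2 := (h ((s + t) / 2)).const_mul 2
    have h3 : Integrable (fun ω ↦ 2 * B ((s + t) / 2) ω - B s ω) P := h2.sub (h s)
    rw [integral_sub h3 (h t), integral_sub h2 (h s), integral_const_mul, hmean, hmean, hmean]
    simp
  have hDi (s t : ℝ) : Integrable (fun ω ↦ secondDiff (B · ω) s t) P :=
    ((isGaussianProcess_secondDiff hB).hasGaussianLaw_eval (s, t)).integrable
  simp only [trapDiff_eq_sum hm]
  rw [integral_finsetSum _ fun _ _ ↦ (hDi _ _).const_mul _]
  simp [integral_const_mul, hD]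

/-- The estimates on two intervals of the nested `k`-adic grids are uncorrelated. -/
theorem covariance_trapDiff_eq_zero (hB : IsGaussianProcess B P) (hab : a ≤ b)
    (hcov : ∀ x ∈ Set.Icc a b, ∀ y ∈ Set.Icc a b, cov[B x, B y; P] = lam * min x y + γ)
    {m k : ℕ} (hm : 0 < m) (hk : 0 < k) (hkeven : Even k) {i j p r : ℕ} (hij : i ≤ j)
    (hp : p < k ^ i) (hr : r < k ^ j) (hne : i = j → p ≠ r) :
    cov[fun ω ↦ trapDiff m (B · ω) (a + (b - a) * (p / k ^ i)) (a + (b - a) * ((p + 1) / k ^ i)),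
      fun ω ↦ trapDiff m (B · ω) (a + (b - a) * (r / k ^ j))
        (a + (b - a) * ((r + 1) / k ^ j)); P] = 0 := by
  have hm' : (0 : ℝ) < m := by positivity
  have hk' : (0 : ℝ) < k := by positivity
  rw [covariance_trapDiff hB hm]
  refine Finset.sum_eq_zero fun l hl ↦ Finset.sum_eq_zero fun l' hl' ↦ ?_
  rw [Finset.mem_range] at hl hl'
  -- Denominator `2 * m * k ^ i`: cell endpoints get even numerators and midpoints odd ones.
  have e (i p : ℕ) (y : ℝ) : a + (b - a) * (p / k ^ i) +
      (a + (b - a) * ((p + 1) / k ^ i) - (a + (b - a) * (p / k ^ i))) * (y / m) =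
      a + (b - a) * ((2 * (m * p + y)) / (2 * m * k ^ i)) := by
    field_simp; ring
  have emid (x y : ℝ) : (a + (b - a) * x + (a + (b - a) * y)) / 2 = a + (b - a) * ((x + y) / 2) := by
    ring
  have mono {x y : ℝ} (h : x ≤ y) : a + (b - a) * x ≤ a + (b - a) * y := by
    have : 0 ≤ b - a := by linarith
    gcongr
  have lb {x : ℝ} (hx : 0 ≤ x) : a ≤ a + (b - a) * x := by simpa using mono hx
  have ub {x : ℝ} (hx : x ≤ 1) : a + (b - a) * x ≤ b := by have := mono hx; linarith
  have top {i p l : ℕ} (hp : p < k ^ i) (hl : l < m) :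
      2 * ((m : ℝ) * p + (l + 1)) / (2 * m * k ^ i) ≤ 1 := by
    rw [div_le_one (by positivity)]
    have h : m * (p + 1) ≤ m * k ^ i := Nat.mul_le_mul_left _ hp
    have h2 : 2 * (m * p + (l + 1)) ≤ 2 * m * k ^ i := by rw [mul_assoc, ← Nat.lt_succ_iff]; lia
    exact_mod_cast h2
  have sep {n : ℕ} (hn : 2 * (m * p + l) ≤ n) (hn' : n ≤ 2 * (m * p + (l + 1))) :
      (n : ℝ) / (2 * m * k ^ i) ≤ 2 * (m * r + l') / (2 * m * k ^ j) ∨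
      2 * (m * r + (l' + 1)) / (2 * m * k ^ j) ≤ (n : ℝ) / (2 * m * k ^ i) := by
    obtain ⟨u, rfl⟩ := Nat.exists_eq_add_of_le hij
    have e : (n : ℝ) / (2 * m * k ^ i) = (n * k ^ u : ℕ) / (2 * m * k ^ (i + u)) := by
      push_cast; field_simp; ring
    have h : n * k ^ u ≤ 2 * (m * r + l') ∨ 2 * (m * r + (l' + 1)) ≤ n * k ^ u := by
      rcases Nat.eq_zero_or_pos u with rfl | hu
      · rcases lt_or_gt_of_ne (hne rfl) with h | h
        · have := Nat.mul_le_mul_left m (Nat.succ_le_of_lt h)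
          left; simp only [pow_zero, mul_one]; lia
        · have := Nat.mul_le_mul_left m (Nat.succ_le_of_lt h)
          right; simp only [pow_zero, mul_one]; lia
      -- Refining by `u > 0` levels makes the numerator `n * k ^ u` even, and no even integer lies
      -- strictly between consecutive even integers. This is where the parity of `k` enters.
      · obtain ⟨w, hw⟩ := (hkeven.pow_of_ne_zero hu.ne').mul_left n
        rw [hw]
        omega
    rw [e]
    refine h.imp (fun h ↦ ?_) (fun h ↦ ?_) <;> gcongr <;> exact_mod_cast h
  rw [e, e, e, e, covariance_secondDiff_eq_zero hB hcov (lb (by positivity))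
    (mono (by gcongr; linarith)) (ub (top hp hl)) (lb (by positivity))
    (mono (by gcongr; linarith)) (ub (top hr hl'))]
  · simp
  · refine (sep (n := 2 * (m * p + l)) le_rfl (by lia)).imp (fun h ↦ mono ?_) (fun h ↦ mono ?_)
      <;> exact_mod_cast h
  · rw [emid, show (2 * ((m : ℝ) * p + l) / (2 * m * k ^ i) +
      2 * ((m : ℝ) * p + (l + 1)) / (2 * m * k ^ i)) / 2 =
        (2 * (m * p + l) + 1) / (2 * m * k ^ i) by field_simp; ring]
    refine (sep (n := 2 * (m * p + l) + 1) (by lia) (by lia)).imp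
      (fun h ↦ mono ?_) (fun h ↦ mono ?_) <;> exact_mod_cast h
  · refine (sep (n := 2 * (m * p + (l + 1))) (by lia) le_rfl).imp
      (fun h ↦ mono ?_) (fun h ↦ mono ?_) <;> exact_mod_cast h

/-- The acceptance probability at depth `i`. -/
theorem measureReal_abs_trapDiff_lt (hB : IsGaussianProcess B P) (hab : a < b) (hlam : 0 < lam)
    (hmean : ∀ x, P[B x] = 0)
    (hcov : ∀ x ∈ Set.Icc a b, ∀ y ∈ Set.Icc a b, cov[B x, B y; P] = lam * min x y + γ)
    {m k : ℕ} (hm : 0 < m) (hk : 0 < k) {i p : ℕ} (hp : p < k ^ i) (ρ τ : ℝ) :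
    P.real {ω | |trapDiff m (B · ω) (a + (b - a) * (p / k ^ i))
      (a + (b - a) * ((p + 1) / k ^ i))| < ρ ^ i * τ} = acceptProb ρ m k τ a b lam i := by
  have hm' : (0 : ℝ) < m := by positivity
  have hk' : (0 : ℝ) < k := by positivity
  have hba : 0 < b - a := by linarith
  set c := a + (b - a) * (p / k ^ i) with hc
  set d := a + (b - a) * ((p + 1) / k ^ i) with hd
  have hp' : (p : ℝ) + 1 ≤ k ^ i := by exact_mod_cast hp
  have hac : a ≤ c := by rw [hc]; simp; positivity
  have hdc : d - c = (b - a) / k ^ i := by rw [hc, hd]; field_simp; ring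
  have hcd : c ≤ d := by
    have : 0 ≤ (b - a) / k ^ i := by positivity
    linarith
  have hdb : d ≤ b := by
    have h1 : ((p : ℝ) + 1) / k ^ i ≤ 1 := by rw [div_le_one (by positivity)]; exact hp'
    have := mul_le_mul_of_nonneg_left h1 hba.le
    rw [hd]; linarith
  have hG := (isGaussianProcess_trapDiff hB hm).hasGaussianLaw_eval (c, d)
  set κ : ℝ := (k : ℝ) ^ (3 / 2 : ℝ) with hκ
  have hκpos : 0 < κ := by positivity
  have hκ2 : κ ^ 2 = k ^ 3 := by
    rw [hκ, ← Real.rpow_natCast, ← Real.rpow_mul hk'.le]; norm_num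
  set s : ℝ := √(lam * (b - a) ^ 3) with hs
  have hspos : 0 < s := by positivity
  have hs2 : s ^ 2 = lam * (b - a) ^ 3 := Real.sq_sqrt (by positivity)
  -- The variance is cubic in the length `(b - a) / k ^ i`, so each level divides the standard
  -- deviation by `κ = k ^ (3 / 2)`.
  have hvar : Var[fun ω ↦ trapDiff m (B · ω) c d; P] = (s / (4 * m * κ ^ i)) ^ 2 := by
    rw [variance_trapDiff hB hcov hm hac hcd hdb, hdc, div_pow s, hs2, mul_pow, ← pow_mul κ,
      mul_comm i, pow_mul κ, hκ2]
    field_simp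
    ring
  have hlaw := hG.map_eq_gaussianReal
  simp only [hvar, integral_trapDiff hB hmean hm] at hlaw
  have hmeas : MeasurableSet {z : ℝ | |z| < ρ ^ i * τ} :=
    measurableSet_lt (by fun_prop) (by fun_prop)
  have := map_measureReal_apply_of_aemeasurable hG.aemeasurable hmeas
  rw [hlaw, gaussianReal_real_abs_lt _ (by positivity)] at this
  rw [acceptProb, ← hκ, ← hs]
  have e : ρ ^ i * τ / (s / (4 * m * κ ^ i)) = 4 * m * τ * (κ * ρ) ^ i / s := by
    rw [mul_pow]; field_simp
  rw [← e, this]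
  rfl

end Covariance

/-! ### Closed form for the recursive calls -/

/-- The index, among the `k ^ v.length` nodes at its depth, of the node `v`. -/
def nodeIndex {k : ℕ} : List (Fin k) → ℕ
  | [] => 0
  | j :: v => j * k ^ v.length + nodeIndex v

theorem nodeIndex_lt {k : ℕ} (v : List (Fin k)) : nodeIndex v < k ^ v.length := by
  induction v with
  | nil => simp [nodeIndex]
  | cons j v ih =>
    have := Nat.mul_le_mul_right (k ^ v.length) (Nat.succ_le_of_lt j.2)
    rw [nodeIndex, List.length_cons, pow_succ']
    lia

theorem nodeIndex_injective_of_length_eq {k : ℕ} {v w : List (Fin k)}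
    (hl : v.length = w.length) (h : nodeIndex v = nodeIndex w) : v = w := by
  induction v generalizing w with
  | nil => exact (List.length_eq_zero_iff.1 hl.symm).symm
  | cons i v ih =>
    cases w with
    | nil => simp at hl
    | cons j w =>
      have hl' : v.length = w.length := by simpa using hl
      have hv := nodeIndex_lt v
      have hw := nodeIndex_lt w
      rw [nodeIndex, nodeIndex, ← hl'] at h
      rw [← hl'] at hw
      have hij : (i : ℕ) = j := by
        rcases lt_trichotomy (i : ℕ) j with hlt | heq | hlt
        · have := Nat.mul_le_mul_right (k ^ v.length) (Nat.succ_le_of_lt hlt)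
          lia
        · exact heq
        · have := Nat.mul_le_mul_right (k ^ v.length) (Nat.succ_le_of_lt hlt)
          lia
      rw [hij] at h
      rw [Fin.ext hij, ih hl' (by lia)]

/-- The call `v` accepts its estimate. -/
def NodeAccepts (ρ : ℝ) (m k : ℕ) (g : ℝ → ℝ) (a b τ : ℝ) (v : List (Fin k)) : Prop :=
  Accepts m g (a + (b - a) * (nodeIndex v / k ^ v.length))
    (a + (b - a) * ((nodeIndex v + 1) / k ^ v.length)) (ρ ^ v.length * τ)

theorem nodeAccepts_cons {ρ : ℝ} {m k : ℕ} {g : ℝ → ℝ} {a b τ : ℝ} (j : Fin k)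
    (v : List (Fin k)) :
    NodeAccepts ρ m k g a b τ (j :: v) ↔
      NodeAccepts ρ m k g (a + (b - a) * (j : ℕ) / k) (a + (b - a) * ((j : ℕ) + 1) / k) (ρ * τ)
        v := by
  have hk : (k : ℝ) ≠ 0 := by exact_mod_cast (Fin.pos j).ne'
  have e (x : ℝ) : a + (b - a) * ((j * k ^ v.length + x) / k ^ (v.length + 1)) =
      a + (b - a) * (j : ℕ) / k + (a + (b - a) * ((j : ℕ) + 1) / k - (a + (b - a) * (j : ℕ) / k)) *
        (x / k ^ v.length) := by
    field_simp; ring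
  simp only [NodeAccepts, nodeIndex, List.length_cons]
  push_cast
  rw [add_assoc ((j : ℝ) * _), e, e, pow_succ, mul_assoc]

/-- `IsCall` recurses from the root; peeling off the last letter instead matches how a tree grows at
its nodes. -/
theorem isCall_concat {ρ : ℝ} {m k : ℕ} {g : ℝ → ℝ} {a b τ : ℝ} (v : List (Fin k)) (j : Fin k) :
    IsCall ρ m k g a b τ (v ++ [j]) ↔ IsCall ρ m k g a b τ v ∧ ¬ NodeAccepts ρ m k g a b τ v := by
  induction v generalizing a b τ with
  | nil => simp [IsCall, NodeAccepts, nodeIndex]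
  | cons i v ih => rw [List.cons_append, IsCall, IsCall, ih, nodeAccepts_cons, and_assoc]

/-! ### Trees and the event that the recursion tree is `T` -/

namespace FullKaryTree

variable {k : ℕ}

theorem isLeaf_or_isInner (T : FullKaryTree k) {v : List (Fin k)} (hv : v ∈ T.nodes) :
    T.IsLeaf v ∨ T.IsInner v := by
  by_cases h : ∃ j, v ++ [j] ∈ T.nodes
  · exact Or.inr ⟨hv, h⟩
  · exact Or.inl ⟨hv, not_exists.1 h⟩

theorem IsLeaf.not_isInner {T : FullKaryTree k} {v : List (Fin k)} (h : T.IsLeaf v) :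
    ¬ T.IsInner v := fun h' ↦ h'.2.elim h.2

theorem concat_mem_iff (T : FullKaryTree k) {v : List (Fin k)} {j : Fin k} :
    v ++ [j] ∈ T.nodes ↔ T.IsInner v :=
  ⟨fun h ↦ ⟨T.parent_mem v j h, j, h⟩, fun ⟨_, i, h⟩ ↦ T.sibling_mem v i j h⟩

theorem length_le_height (T : FullKaryTree k) (hT : T.IsFinite) {v : List (Fin k)}
    (hv : v ∈ T.nodes) : v.length ≤ T.height.toNat := by
  have hle : ((v.length : ℕ) : ℕ∞) ≤ T.height :=
    le_iSup₂ (f := fun v _ ↦ ((v.length : ℕ) : ℕ∞)) v hv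
  have hfin : T.height ≠ ⊤ := by
    obtain ⟨N, hN⟩ := (hT.image List.length).bddAbove
    have : T.height ≤ (N : ℕ∞) := iSup₂_le fun w hw ↦ by
      exact_mod_cast hN (Set.mem_image_of_mem _ hw)
    exact ne_top_of_le_ne_top (ENat.natCast_ne_top N) this
  exact (ENat.toNat_le_toNat hle hfin)

end FullKaryTree

theorem recursionTree_eq_iff {ρ : ℝ} {m k : ℕ} {g : ℝ → ℝ} {a b τ : ℝ} (hk : 0 < k)
    (T : FullKaryTree k) :
    recursionTree ρ m k g a b τ = T ↔
      ∀ v ∈ T.nodes, (NodeAccepts ρ m k g a b τ v ↔ T.IsLeaf v) := by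
  constructor
  · rintro rfl v hv
    have h (j : Fin k) : v ++ [j] ∈ (recursionTree ρ m k g a b τ).nodes ↔
        ¬ NodeAccepts ρ m k g a b τ v := by
      change IsCall ρ m k g a b τ (v ++ [j]) ↔ _
      rw [isCall_concat]
      exact and_iff_right hv
    simp only [FullKaryTree.IsLeaf, h, not_not]
    -- A child index must exist: for `k = 0` every node would be a leaf, whether it accepts or not.
    exact ⟨fun h ↦ ⟨hv, fun _ ↦ h⟩, fun h ↦ h.2 ⟨0, hk⟩⟩
  · intro h
    ext v
    change IsCall ρ m k g a b τ v ↔ v ∈ T.nodes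
    induction v using List.reverseRecOn with
    | nil => exact iff_of_true trivial T.root_mem
    | append_singleton v j ih =>
      rw [isCall_concat, ih, T.concat_mem_iff]
      constructor
      · rintro ⟨hv, hacc⟩
        exact (T.isLeaf_or_isInner hv).resolve_left fun hl ↦ hacc ((h v hv).2 hl)
      · intro hi
        exact ⟨hi.1, fun hacc ↦ ((h v hi.1).1 hacc).not_isInner hi⟩

/-- A product over the nodes of a finite tree, grouped by depth. -/
theorem FullKaryTree.prod_nodes {k : ℕ} (T : FullKaryTree k) (hT : T.IsFinite) (α β : ℕ → ℝ)
    [DecidablePred T.IsLeaf] :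
    ∏ v ∈ hT.toFinset, (if T.IsLeaf v then α v.length else β v.length) =
      ∏ i ∈ Finset.range (T.height.toNat + 1), α i ^ T.numLeaves i * β i ^ T.numInner i := by
  classical
  have hmaps : ∀ v ∈ hT.toFinset, v.length ∈ Finset.range (T.height.toNat + 1) := fun v hv ↦ by
    have := T.length_le_height hT ((Set.Finite.mem_toFinset hT).1 hv)
    exact Finset.mem_range.2 (by lia)
  rw [← Finset.prod_fiberwise_of_maps_to hmaps]
  refine Finset.prod_congr rfl fun i _ ↦ ?_
  have e : ∏ v ∈ hT.toFinset with v.length = i, (if T.IsLeaf v then α v.length else β v.length) =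
      ∏ v ∈ hT.toFinset with v.length = i, (if T.IsLeaf v then α i else β i) :=
    Finset.prod_congr rfl fun v hv ↦ by rw [(Finset.mem_filter.1 hv).2]
  rw [e, Finset.prod_ite, Finset.prod_const, Finset.prod_const, numLeaves, numInner,
    ← Set.ncard_coe_finset, ← Set.ncard_coe_finset]
  congr 4 <;> ext v
  · have h1 : T.IsLeaf v → v ∈ T.nodes := And.left
    have hm : v ∈ hT.toFinset ↔ v ∈ T.nodes := Set.Finite.mem_toFinset hT
    simp only [Finset.coe_filter, Finset.mem_filter, Set.mem_ofPred_eq, hm]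
    tauto
  · have h1 : T.IsInner v → v ∈ T.nodes := And.left
    have h2 : T.IsLeaf v → ¬ T.IsInner v := IsLeaf.not_isInner
    have h3 : v ∈ T.nodes → T.IsLeaf v ∨ T.IsInner v := T.isLeaf_or_isInner
    have hm : v ∈ hT.toFinset ↔ v ∈ T.nodes := Set.Finite.mem_toFinset hT
    simp only [Finset.coe_filter, Finset.mem_filter, Set.mem_ofPred_eq, hm]
    tauto

theorem mainTheorem4 {a b : ℝ} (hab : a < b) (ρ τ lam γ : ℝ) (hρ : 0 < ρ) (hτ : 0 < τ)
    (hlam : 0 < lam) (m k : ℕ) (hm : 0 < m) (hk : 0 < k) (hkeven : Even k)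
    [MeasurableSpace C(Set.Icc a b, ℝ)] [BorelSpace C(Set.Icc a b, ℝ)]
    (P : Measure C(Set.Icc a b, ℝ)) (hP : IsShiftedScaledWienerLaw lam γ P)
    (T : FullKaryTree k) (hT : T.IsFinite) :
    P.real {f | adapTrapTree ρ m k τ hab f = T} =
      ∏ i ∈ Finset.range (T.height.toNat + 1),
        acceptProb ρ m k τ a b lam i ^ T.numLeaves i *
          (1 - acceptProb ρ m k τ a b lam i) ^ T.numInner i := by
  classical
  -- Constant extension beyond `[a, b]` keeps the process Gaussian and centred on the whole line;
  -- the covariance formula is needed on `[a, b]` only.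
  let B : ℝ → C(Set.Icc a b, ℝ) → ℝ := fun x f ↦ Set.IccExtend hab.le f x
  have hB : IsGaussianProcess B P := hP.isGaussianProcess.comp_right (Set.projIcc a b hab.le)
  have := hB.isProbabilityMeasure
  have hmean (x : ℝ) : P[B x] = 0 := hP.mean_eq _
  have hcov : ∀ x ∈ Set.Icc a b, ∀ y ∈ Set.Icc a b, cov[B x, B y; P] = lam * min x y + γ := by
    intro x hx y hy
    have h := hP.cov_eq ⟨x, hx⟩ ⟨y, hy⟩
    rw [← Set.projIcc_of_mem hab.le hx, ← Set.projIcc_of_mem hab.le hy] at h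
    simpa [Set.projIcc_of_mem hab.le hx, Set.projIcc_of_mem hab.le hy, B, Set.IccExtend,
      Function.comp_def] using h
  let Δ : List (Fin k) → C(Set.Icc a b, ℝ) → ℝ := fun v f ↦
    trapDiff m (B · f) (a + (b - a) * (nodeIndex v / k ^ v.length))
      (a + (b - a) * ((nodeIndex v + 1) / k ^ v.length))
  have hΔ : IsGaussianProcess Δ P := (isGaussianProcess_trapDiff hB hm).comp_right fun v ↦
    (a + (b - a) * (nodeIndex v / k ^ v.length), a + (b - a) * ((nodeIndex v + 1) / k ^ v.length))
  have hΔcov (v w : List (Fin k)) (hvw : v ≠ w) : cov[Δ v, Δ w; P] = 0 := by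
    rcases le_total v.length w.length with h | h
    · exact covariance_trapDiff_eq_zero hB hab.le hcov hm hk hkeven h (nodeIndex_lt v)
        (nodeIndex_lt w) fun hl hi ↦ hvw (nodeIndex_injective_of_length_eq hl hi)
    · rw [covariance_comm]
      exact covariance_trapDiff_eq_zero hB hab.le hcov hm hk hkeven h (nodeIndex_lt w)
        (nodeIndex_lt v) fun hl hi ↦ hvw (nodeIndex_injective_of_length_eq hl hi).symm
  -- Uncorrelated components of a jointly Gaussian finite family are mutually independent.
  have hind : iIndepFun (fun v : hT.toFinset ↦ Δ v) P :=
    (hΔ.hasGaussianLaw hT.toFinset).iIndepFun_of_covariance_eq_zero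
      fun v w hvw ↦ hΔcov v w (Subtype.coe_injective.ne hvw)
  let A : List (Fin k) → Set ℝ := fun v ↦
    if T.IsLeaf v then {z | |z| < ρ ^ v.length * τ} else {z | |z| < ρ ^ v.length * τ}ᶜ
  have hAmeas (v : List (Fin k)) : MeasurableSet (A v) := by
    have : MeasurableSet {z : ℝ | |z| < ρ ^ v.length * τ} :=
      measurableSet_lt (by fun_prop) (by fun_prop)
    simp only [A]
    split_ifs
    exacts [this, this.compl]
  have hset : {f | adapTrapTree ρ m k τ hab f = T} =
      ⋂ v ∈ (Finset.univ : Finset hT.toFinset), Δ v ⁻¹' A v := by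
    ext f
    simp only [Set.mem_ofPred_eq, adapTrapTree, recursionTree_eq_iff hk, Finset.mem_univ,
      Set.iInter_true, Set.mem_iInter, Set.mem_preimage, Subtype.forall]
    refine forall_congr' fun v ↦ imp_congr (Set.Finite.mem_toFinset hT).symm ?_
    have : NodeAccepts ρ m k (Set.IccExtend hab.le f) a b τ v ↔ |Δ v f| < ρ ^ v.length * τ :=
      Iff.rfl
    by_cases hl : T.IsLeaf v <;> simp [A, hl, this]
  have hprob (v : List (Fin k)) : P.real (Δ v ⁻¹' A v) =
      if T.IsLeaf v then acceptProb ρ m k τ a b lam v.length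
        else 1 - acceptProb ρ m k τ a b lam v.length := by
    have h := measureReal_abs_trapDiff_lt hB hab hlam hmean hcov hm hk (nodeIndex_lt v) ρ τ
    have hn : NullMeasurableSet (Δ v ⁻¹' {z | |z| < ρ ^ v.length * τ}) P :=
      (hΔ.aemeasurable v).nullMeasurableSet_preimage
        (measurableSet_lt (by fun_prop) (by fun_prop))
    simp only [A]
    split_ifs
    · exact h
    · rw [Set.preimage_compl, probReal_compl_eq_one_sub₀ hn]
      exact congrArg (1 - ·) h
  rw [hset, measureReal_def, hind.measure_inter_preimage_eq_mul Finset.univ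
    (sets := fun v ↦ A v) fun v _ ↦ hAmeas v, ENNReal.toReal_prod]
  simp only [← measureReal_def, hprob]
  rw [Finset.prod_coe_sort hT.toFinset (fun v ↦ if T.IsLeaf v then
    acceptProb ρ m k τ a b lam v.length else 1 - acceptProb ρ m k τ a b lam v.length)]
  exact T.prod_nodes hT _ fun i ↦ 1 - acceptProb ρ m k τ a b lam i
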